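/- Let $E$ and $F$ be complex Banach spaces, let $U\subseteq E$ be open, let $1<p\le\infty$, and let $p^*\in[1,\infty)$ be the conjugate index, $\frac1p+\frac1{p^*}=1$ (so $p^*=1$ if $p=\infty$). Let $\mathcal H^\infty(U,F)$ be the space of bounded holomorphic mappings $f\colon U\to F$ with the supremum norm, $\mathcal H^\infty(U)=\mathcal H^\infty(U,\mathbb C)$, and let $B_X$ denote the closed unit ball of a Banach space $X$. A holomorphic mapping $f\colon U\to F$ is Cohen strongly $p$-summing if there is a constant $C\ge0$ such that for all $n\in\mathbb N$, $\lambda_1,\dots,\lambda_n\in\mathbb C$, $x_1,\dots,x_n\in U$ and $y_1^*,\dots,y_n^*\in F^*$, $$\sum_{i=1}^n|\lambda_i|\,|\langle y_i^*,f(x_i)\rangle|\le C\,\Big(\sum_{i=1}^n|\lambda_i|^p\Big)^{1/p}\sup_{y^{**}\in B_{F^{**}}}\Big(\sum_{i=1}^n|y^{**}(y_i^*)|^{p^*}\Big)^{1/p^*},$$ where $\big(\sum_i|\lambda_i|^p\big)^{1/p}$ is read as $\max_i|\lambda_i|$ if $p=\infty$; the infimum of such $C$ is denoted $d_p^{\mathcal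 H^\infty}(f)$. A bounded linear operator $T\colon X\to Y$ between Banach spaces is absolutely $q$-summing ($1\le q<\infty$) if there is $C\ge0$ such that for all $n\in\mathbb N$ and $x_1,\dots,x_n\in X$, $$\Big(\sum_{i=1}^n\|T(x_i)\|^q\Big)^{1/q}\le C\sup_{x^*\in B_{X^*}}\Big(\sum_{i=1}^n|x^*(x_i)|^q\Big)^{1/q};$$ the infimum of such $C$ is denoted $\pi_q(T)$. Theorem. Let $f\in\mathcal H^\infty(U,F)$, with transpose $f^t\colon F^*\to\mathcal H^\infty(U)$, $f^t(y^*)=y^*\circ f$ (a bounded linear operator). Then $f$ is Cohen strongly $p$-summing if and only if $f^t$ is absolutely $p^*$-summing. In this case, $d_p^{\mathcal H^\infty}(f)=\pi_{p^*}(f^t)$. -/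

import Mathlib

open scoped ENNReal BoundedContinuousFunction Topology

noncomputable section

namespace CohenHolo

open TopologicalSpace

section Holomorphic

variable {E F : Type*} [NormedAddCommGroup E] [NormedSpace ℂ E]
  [NormedAddCommGroup F] [NormedSpace ℂ F]

/-- A mapping `f : U → F` on an open subset `U` of a complex normed space `E` is holomorphic if it
is complex Fréchet differentiable at every point `a` of `U`: there is a bounded linear operator `T`
with `f x - f a - T (x - a) = o(x - a)` as `x → a` in `U`. -/
def IsHolomorphic (U : Opens E) (f : U → F) : Prop :=
  ∀ a : U, ∃ T : E →L[ℂ] F,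
    (fun x : U => f x - f a - T ((x : E) - (a : E))) =o[𝓝 a] (fun x : U => (x : E) - (a : E))

theorem IsHolomorphic.clm_comp {G : Type*} [NormedAddCommGroup G] [NormedSpace ℂ G]
    {U : Opens E} {f : U → F} (hf : IsHolomorphic U f) (L : F →L[ℂ] G) :
    IsHolomorphic U (fun x => L (f x)) := by
  intro a
  obtain ⟨T, hT⟩ := hf a
  refine ⟨L.comp T, ?_⟩
  have h := (L.isBigO_comp (fun x : U => f x - f a - T ((x : E) - (a : E))) (𝓝 a)).trans_isLittleO hT
  refine h.congr_left fun x => ?_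
  simp only [map_sub, ContinuousLinearMap.comp_apply]

variable (F) in
/-- The space `H^∞(U, F)` of bounded holomorphic mappings from `U` to `F`. As a subspace of the
bounded continuous mappings on `U` (holomorphic mappings are continuous) it carries the supremum
norm. -/
def HInf (U : Opens E) : Submodule ℂ (U →ᵇ F) where
  carrier := {f | IsHolomorphic U f}
  zero_mem' := by
    intro a
    refine ⟨0, ?_⟩
    simp
  add_mem' := by
    intro f g hf hg a
    obtain ⟨S, hS⟩ := hf a
    obtain ⟨T, hT⟩ := hg a
    refine ⟨S + T, (hS.add hT).congr_left fun x => ?_⟩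
    simp only [BoundedContinuousFunction.coe_add, Pi.add_apply, add_apply]
    abel
  smul_mem' := by
    intro c f hf a
    obtain ⟨T, hT⟩ := hf a
    refine ⟨c • T, (hT.const_smul_left c).congr_left fun x => ?_⟩
    simp only [BoundedContinuousFunction.coe_smul, smul_apply, smul_sub,
      Pi.smul_apply]

/-- The composition `y^* ∘ f ∈ H^∞(U)` for `f ∈ H^∞(U, F)` and `y^* ∈ F^*`. -/
def HInf.dualComp {U : Opens E} (f : HInf F U) (y : StrongDual ℂ F) : HInf ℂ U :=
  ⟨BoundedContinuousFunction.ofNormedAddCommGroup (fun x : U => y (f.1 x))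
      (y.continuous.comp f.1.continuous) (‖y‖ * ‖f‖)
      (fun x => (y.le_opNorm _).trans
        (mul_le_mul_of_nonneg_left (f.1.norm_coe_le_norm x) (norm_nonneg y))),
    IsHolomorphic.clm_comp f.2 y⟩

/-- The transpose `f^t : F^* → H^∞(U)`, `y^* ↦ y^* ∘ f`, as a bounded linear operator. -/
def HInf.transpose {U : Opens E} (f : HInf F U) : StrongDual ℂ F →L[ℂ] HInf ℂ U :=
  LinearMap.mkContinuous
    { toFun := fun y => HInf.dualComp f y
      map_add' := fun _ _ => rfl
      map_smul' := fun _ _ => rfl }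
    ‖f‖
    (fun y => by
      rw [mul_comm]
      exact BoundedContinuousFunction.norm_ofNormedAddCommGroup_le
        (y.continuous.comp f.1.continuous) (mul_nonneg (norm_nonneg y) (norm_nonneg f))
        (fun x => (y.le_opNorm _).trans
          (mul_le_mul_of_nonneg_left (f.1.norm_coe_le_norm x) (norm_nonneg y))))

end Holomorphic

/-- The `ℓ_p`-norm of a finite family of nonnegative reals, `1 ≤ p ≤ ∞`:
the maximum for `p = ∞`, and `(∑ a_i ^ p) ^ (1 / p)` for `p < ∞`. -/
def finLpNorm (p : ℝ≥0∞) {n : ℕ} (a : Fin n → ℝ) : ℝ :=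
  if p = ∞ then ⨆ i, a i else (∑ i, a i ^ p.toReal) ^ (1 / p.toReal)

/-- The weak `ℓ_p`-norm `sup_{x^* ∈ B_{X^*}} ‖(x^*(x_i))_i‖_p` of a finite family in `X`. -/
def weakLpNorm {X : Type*} [NormedAddCommGroup X] [NormedSpace ℂ X] (p : ℝ≥0∞) {n : ℕ}
    (x : Fin n → X) : ℝ :=
  ⨆ φ : Metric.closedBall (0 : StrongDual ℂ X) 1, finLpNorm p (fun i => ‖φ.1 (x i)‖)

section Summing

variable {X Y : Type*} [NormedAddCommGroup X] [NormedSpace ℂ X]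
  [NormedAddCommGroup Y] [NormedSpace ℂ Y]

/-- `C ≥ 0` is admissible in the definition of an absolutely `p`-summing operator. -/
def IsSummingConst (p : ℝ≥0∞) (T : X →L[ℂ] Y) (C : ℝ) : Prop :=
  0 ≤ C ∧ ∀ (n : ℕ) (x : Fin n → X),
    finLpNorm p (fun i => ‖T (x i)‖) ≤ C * weakLpNorm p x

/-- Absolutely `p`-summing operators. -/
def IsSumming (p : ℝ≥0∞) (T : X →L[ℂ] Y) : Prop :=
  ∃ C : ℝ, IsSummingConst p T C

/-- `π_p(T)`, the infimum of the admissible constants. -/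
def summingNorm (p : ℝ≥0∞) (T : X →L[ℂ] Y) : ℝ :=
  sInf {C : ℝ | IsSummingConst p T C}

end Summing

section Cohen

variable {E F : Type*} [NormedAddCommGroup E] [NormedSpace ℂ E]
  [NormedAddCommGroup F] [NormedSpace ℂ F]

/-- `C ≥ 0` is admissible in the definition of a Cohen strongly `p`-summing mapping `f : U → F`.
The supremum in `weakLpNorm` is over the unit ball of `F^{**}`, since the `y_i` lie in `F^*`;
`ENNReal.conjExponent p` is the conjugate index of `p`. -/
def IsCohenConst (p : ℝ≥0∞) {U : Opens E} (f : U → F) (C : ℝ) : Prop :=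
  0 ≤ C ∧ ∀ (n : ℕ) (c : Fin n → ℂ) (x : Fin n → U) (y : Fin n → StrongDual ℂ F),
    ∑ i, ‖c i‖ * ‖y i (f (x i))‖ ≤
      C * finLpNorm p (fun i => ‖c i‖) * weakLpNorm (ENNReal.conjExponent p) y

/-- Cohen strongly `p`-summing holomorphic mappings. -/
def IsCohenSumming (p : ℝ≥0∞) {U : Opens E} (f : U → F) : Prop :=
  IsHolomorphic U f ∧ ∃ C : ℝ, IsCohenConst p f C

/-- `d_p^{H^∞}(f)`, the infimum of the admissible constants. -/
def cohenNorm (p : ℝ≥0∞) {U : Opens E} (f : U → F) : ℝ :=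
  sInf {C : ℝ | IsCohenConst p f C}

end Cohen

end CohenHolo

end

namespace CohenHolo

/-! Both properties have exactly the same admissible constants `C`, which gives the equivalence and
the equality of the infima at once. The link is `‖f^t(y)‖ = sup_x ‖y (f x)‖` together with the
duality of `ℓ_p` and `ℓ_{p^*}` on finite families. Summing implies Cohen by Hölder
(`sum_mul_le_finLpNorm_mul_finLpNorm`). Conversely, the points `x i` are chosen to nearly attain
`‖f^t(y i)‖`, and the scalars are removed by the converse of Hölder (`finLpNorm_conjExponent_le`).
The weak norm is the same on both sides; only its nonnegativity matters. -/

theorem finLpNorm_nonneg (p : ℝ≥0∞) {n : ℕ} {a : Fin n → ℝ} (ha : ∀ i, 0 ≤ a i) :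
    0 ≤ finLpNorm p a := by
  unfold finLpNorm
  split_ifs
  · exact Real.iSup_nonneg ha
  · exact Real.rpow_nonneg (Finset.sum_nonneg fun i _ => Real.rpow_nonneg (ha i) _) _

theorem finLpNorm_mono {p : ℝ≥0∞} (hp : p ≠ ∞) {n : ℕ} {a b : Fin n → ℝ}
    (ha : ∀ i, 0 ≤ a i) (hab : ∀ i, a i ≤ b i) : finLpNorm p a ≤ finLpNorm p b := by
  simp only [finLpNorm, if_neg hp]
  refine Real.rpow_le_rpow (Finset.sum_nonneg fun i _ => Real.rpow_nonneg (ha i) _)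
    (Finset.sum_le_sum fun i _ => Real.rpow_le_rpow (ha i) (hab i) ENNReal.toReal_nonneg)
    (by positivity)

theorem continuous_finLpNorm {p : ℝ≥0∞} (hp : p ≠ ∞) (n : ℕ) :
    Continuous (finLpNorm p : (Fin n → ℝ) → ℝ) := by
  have h : (finLpNorm p : (Fin n → ℝ) → ℝ) =
      fun a => (∑ i, a i ^ p.toReal) ^ (1 / p.toReal) := by
    funext a
    simp only [finLpNorm, if_neg hp]
  rw [h]
  exact (continuous_finsetSum _ fun i _ =>
    (continuous_apply i).rpow_const fun _ => Or.inr ENNReal.toReal_nonneg).rpow_const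
      fun _ => Or.inr (by positivity)

theorem weakLpNorm_nonneg {X : Type*} [NormedAddCommGroup X] [NormedSpace ℂ X] (p : ℝ≥0∞) {n : ℕ}
    (x : Fin n → X) : 0 ≤ weakLpNorm p x :=
  Real.iSup_nonneg fun _ => finLpNorm_nonneg p fun _ => norm_nonneg _

theorem finLpNorm_one {n : ℕ} (a : Fin n → ℝ) : finLpNorm 1 a = ∑ i, a i := by
  simp [finLpNorm]

theorem conjExponent_top : ENNReal.conjExponent ∞ = 1 := by
  simp [ENNReal.conjExponent]

theorem conjExponent_ne_top {p : ℝ≥0∞} (hp : 1 < p) : ENNReal.conjExponent p ≠ ∞ := by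
  simp [ENNReal.conjExponent, tsub_eq_zero_iff_le, hp]

theorem holderConjugate_toReal_conjExponent {p : ℝ≥0∞} (hp : 1 < p) (hp' : p ≠ ∞) :
    p.toReal.HolderConjugate (ENNReal.conjExponent p).toReal := by
  have := ENNReal.HolderConjugate.conjExponent hp.le
  exact ENNReal.HolderConjugate.toReal_of_ne_top hp' (conjExponent_ne_top hp)

/-- Hölder's inequality for finite families. -/
theorem sum_mul_le_finLpNorm_mul_finLpNorm {p : ℝ≥0∞} (hp : 1 < p) {n : ℕ} {a b : Fin n → ℝ}
    (ha : ∀ i, 0 ≤ a i) (hb : ∀ i, 0 ≤ b i) :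
    ∑ i, a i * b i ≤ finLpNorm p a * finLpNorm (ENNReal.conjExponent p) b := by
  by_cases hp' : p = ∞
  · subst hp'
    rw [conjExponent_top, finLpNorm_one, Finset.mul_sum]
    refine Finset.sum_le_sum fun i _ => mul_le_mul_of_nonneg_right ?_ (hb i)
    simpa [finLpNorm] using le_ciSup (Set.finite_range a).bddAbove i
  · simpa only [finLpNorm, if_neg hp', if_neg (conjExponent_ne_top hp)] using
      Real.inner_le_Lp_mul_Lq_of_nonneg Finset.univ
        (holderConjugate_toReal_conjExponent hp hp') (fun i _ => ha i) (fun i _ => hb i)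

/-- The converse of Hölder's inequality for finite families. -/
theorem finLpNorm_conjExponent_le {p : ℝ≥0∞} (hp : 1 < p) {n : ℕ} {a : Fin n → ℝ}
    (ha : ∀ i, 0 ≤ a i) {K : ℝ} (hK : 0 ≤ K)
    (h : ∀ c : Fin n → ℂ, ∑ i, ‖c i‖ * a i ≤ K * finLpNorm p (fun i => ‖c i‖)) :
    finLpNorm (ENNReal.conjExponent p) a ≤ K := by
  by_cases hp' : p = ∞
  · subst hp'
    rw [conjExponent_top, finLpNorm_one]
    rcases isEmpty_or_nonempty (Fin n) with _ | _
    -- The split is needed because the maximum over an empty family is `0`, so the constant family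
    -- `1` has norm `1` only when `n > 0`.
    · simpa using hK
    · simpa [finLpNorm] using h fun _ => 1
  have hpq := holderConjugate_toReal_conjExponent hp hp'
  -- Equality case of Hölder: with `c i = a i ^ (q - 1)` and `(q - 1) r = q`, both `c i * a i` and
  -- `c i ^ r` equal `a i ^ q`.
  have hc := h fun i => ((a i ^ ((ENNReal.conjExponent p).toReal - 1) : ℝ) : ℂ)
  simp only [finLpNorm, if_neg hp', if_neg (conjExponent_ne_top hp)] at hc ⊢
  set q := (ENNReal.conjExponent p).toReal
  set r := p.toReal
  have hq : 1 < q := hpq.symm.lt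
  have hnorm : ∀ i, ‖((a i ^ (q - 1) : ℝ) : ℂ)‖ = a i ^ (q - 1) := fun i => by
    rw [Complex.norm_real, Real.norm_of_nonneg (Real.rpow_nonneg (ha i) _)]
  have h1 : ∀ i, a i ^ (q - 1) * a i = a i ^ q := fun i => by
    have := Real.rpow_add_one' (ha i) (y := q - 1) (by linarith)
    rw [← this, sub_add_cancel]
  have h2 : ∀ i, (a i ^ (q - 1)) ^ r = a i ^ q := fun i => by
    rw [← Real.rpow_mul (ha i), hpq.symm.sub_one_mul_conj]
  simp only [hnorm, h1, h2] at hc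
  have hS : 0 ≤ ∑ i, a i ^ q := Finset.sum_nonneg fun i _ => Real.rpow_nonneg (ha i) _
  rcases hS.eq_or_lt with hS | hS
  · rw [← hS, Real.zero_rpow (by positivity)]
    exact hK
  -- With `S = ∑ a i ^ q > 0`, `hc` reads `S ≤ K * S ^ (1 / r)`; dividing by `S ^ (1 / r)` leaves `S
  -- ^ (1 / q) ≤ K`.
  · refine le_of_mul_le_mul_right ?_ (Real.rpow_pos_of_pos hS (1 / r))
    rw [← Real.rpow_add hS, add_comm, one_div, one_div, hpq.inv_add_inv_eq_one, Real.rpow_one]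
    simpa only [one_div] using hc

section

variable {E F : Type*} [NormedAddCommGroup E] [NormedSpace ℂ E]
  [NormedAddCommGroup F] [NormedSpace ℂ F] {U : TopologicalSpace.Opens E}

theorem HInf.norm_apply_le_norm_transpose (f : HInf F U) (y : StrongDual ℂ F) (x : U) :
    ‖y (f.1 x)‖ ≤ ‖HInf.transpose f y‖ :=
  (HInf.dualComp f y).1.norm_coe_le_norm x

theorem HInf.exists_norm_transpose_sub_le [Nonempty U] (f : HInf F U) (y : StrongDual ℂ F)
    {ε : ℝ} (hε : 0 < ε) : ∃ x : U, ‖HInf.transpose f y‖ - ε ≤ ‖y (f.1 x)‖ := by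
  by_contra! h
  have : ‖HInf.transpose f y‖ ≤ ‖HInf.transpose f y‖ - ε :=
    (BoundedContinuousFunction.norm_le_of_nonempty (f := (HInf.dualComp f y).1)).2
      fun x => (h x).le
  linarith

theorem HInf.transpose_eq_zero [IsEmpty U] (f : HInf F U) (y : StrongDual ℂ F) :
    HInf.transpose f y = 0 :=
  Subtype.ext (BoundedContinuousFunction.ext fun x => isEmptyElim x)

theorem IsSummingConst.isCohenConst {p : ℝ≥0∞} (hp : 1 < p) {f : HInf F U} {C : ℝ}
    (h : IsSummingConst (ENNReal.conjExponent p) (HInf.transpose f) C) :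
    IsCohenConst p (fun x : U => f.1 x) C := by
  refine ⟨h.1, fun n c x y => ?_⟩
  calc ∑ i, ‖c i‖ * ‖y i (f.1 (x i))‖
      ≤ ∑ i, ‖c i‖ * ‖HInf.transpose f (y i)‖ := by
        gcongr with i
        exact HInf.norm_apply_le_norm_transpose f (y i) (x i)
    _ ≤ finLpNorm p (fun i => ‖c i‖) *
          finLpNorm (ENNReal.conjExponent p) (fun i => ‖HInf.transpose f (y i)‖) :=
        sum_mul_le_finLpNorm_mul_finLpNorm hp (fun _ => norm_nonneg _) (fun _ => norm_nonneg _)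
    _ ≤ finLpNorm p (fun i => ‖c i‖) * (C * weakLpNorm (ENNReal.conjExponent p) y) :=
        mul_le_mul_of_nonneg_left (h.2 n y) (finLpNorm_nonneg p fun _ => norm_nonneg _)
    _ = C * finLpNorm p (fun i => ‖c i‖) * weakLpNorm (ENNReal.conjExponent p) y := by ring

theorem IsCohenConst.isSummingConst {p : ℝ≥0∞} (hp : 1 < p) {f : HInf F U} {C : ℝ}
    (h : IsCohenConst p (fun x : U => f.1 x) C) :
    IsSummingConst (ENNReal.conjExponent p) (HInf.transpose f) C := by
  refine ⟨h.1, fun n y => ?_⟩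
  have hK : 0 ≤ C * weakLpNorm (ENNReal.conjExponent p) y := mul_nonneg h.1 (weakLpNorm_nonneg _ _)
  have hq := conjExponent_ne_top hp
  -- If `U` is empty there are no points to choose, but then `f^t = 0`.
  rcases isEmpty_or_nonempty U with _ | _
  · refine finLpNorm_conjExponent_le hp (fun _ => norm_nonneg _) hK fun c => ?_
    simpa [HInf.transpose_eq_zero] using
      mul_nonneg hK (finLpNorm_nonneg p fun i => norm_nonneg (c i))
  -- The supremum over `U` need not be attained, hence the loss `ε`. Truncating at `0` keeps the
  -- entries nonnegative, as monotonicity of the `ℓ_{p^*}`-norm requires.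
  have hbound : ∀ ε : ℝ, 0 < ε → finLpNorm (ENNReal.conjExponent p)
      (fun i => max (‖HInf.transpose f (y i)‖ - ε) 0) ≤
        C * weakLpNorm (ENNReal.conjExponent p) y := by
    intro ε hε
    choose x hx using fun i => HInf.exists_norm_transpose_sub_le f (y i) hε
    refine (finLpNorm_mono hq (fun _ => le_max_right _ _)
      fun i => max_le (hx i) (norm_nonneg _)).trans ?_
    refine finLpNorm_conjExponent_le hp (fun _ => norm_nonneg _) hK fun c => ?_
    exact (h.2 n c x y).trans_eq (mul_right_comm _ _ _)
  have hcont : Continuous fun ε : ℝ => finLpNorm (ENNReal.conjExponent p)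
      (fun i => max (‖HInf.transpose f (y i)‖ - ε) 0) :=
    (continuous_finLpNorm hq n).comp (by fun_prop)
  -- As `ε → 0⁺` the truncated entries tend to `‖f^t(y i)‖`, and the bound does not depend on `ε`.
  have hlim := (hcont.tendsto 0).mono_left (nhdsWithin_le_nhds (s := Set.Ioi 0))
  simp only [sub_zero, norm_nonneg, sup_of_le_left] at hlim
  exact le_of_tendsto hlim (eventually_nhdsWithin_of_forall fun ε hε => hbound ε hε)

theorem isCohenConst_iff_isSummingConst {p : ℝ≥0∞} (hp : 1 < p) (f : HInf F U) (C : ℝ) :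
    IsCohenConst p (fun x : U => f.1 x) C ↔
      IsSummingConst (ENNReal.conjExponent p) (HInf.transpose f) C :=
  ⟨fun h => h.isSummingConst hp, fun h => h.isCohenConst hp⟩

end

end CohenHolo

theorem mainTheorem7 {E F : Type*}
    [NormedAddCommGroup E] [NormedSpace ℂ E] [CompleteSpace E]
    [NormedAddCommGroup F] [NormedSpace ℂ F] [CompleteSpace F]
    (U : TopologicalSpace.Opens E) (p : ℝ≥0∞) (hp : 1 < p) (f : CohenHolo.HInf F U) :
    (CohenHolo.IsCohenSumming p (fun x : U => f.1 x) ↔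
      CohenHolo.IsSumming (ENNReal.conjExponent p) (CohenHolo.HInf.transpose f)) ∧
    (CohenHolo.IsCohenSumming p (fun x : U => f.1 x) →
      CohenHolo.cohenNorm p (fun x : U => f.1 x) =
        CohenHolo.summingNorm (ENNReal.conjExponent p) (CohenHolo.HInf.transpose f)) := by
  have h := CohenHolo.isCohenConst_iff_isSummingConst hp f
  refine ⟨⟨fun hf => hf.2.imp fun C => (h C).1, fun hf => ⟨f.2, hf.imp fun C => (h C).2⟩⟩,
    fun _ => ?_⟩
  simp only [CohenHolo.cohenNorm, CohenHolo.summingNorm, h]
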